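/- Let $\sigma\in\{\mathrm{Sigmoid},\tanh\}$, where $\mathrm{Sigmoid}(x)=\frac{1}{1+e^{-x}}$, and let $\ell\ge 1$ be a number of colors. Graphs are finite, undirected and simple, and each vertex $v$ carries exactly one color in $\{1,\dots,\ell\}$; $N_G(v)$ denotes the set of neighbors of $v$ in $G$. The GC2 formulas are the formulas in one free variable built from the atoms $\mathrm{Col}_i(x)$ ("$x$ has color $i$") by $\lnot\varphi(x)$, $\varphi(x)\wedge\psi(x)$ and $\exists^{\ge p}y\,(E(x,y)\wedge\varphi(y))$ with $p$ a positive integer; a GC2 query $Q$ assigns to each graph $G$ the set $Q(G)$ of the vertices at which a fixed GC2 formula holds. A GNN with activation $\sigma$ consists of finitely many, at least one, combination functions $\mathsf{comb}_1,\dots,\mathsf{comb}_T$, each of which is a neural network $T_{k+1}\circ\sigma\circ T_k\circ\cdots\circ\sigma\circ T_1$ with some number $k\ge 0$ of hidden layers, real affine maps $T_i$ and $\sigma$ applied coordinatewise. On a graph $G$ it computes $\xi^0(v)=e_i\in\mathbb{R}^\ell$ if $v$ has color $i$, and $$\xi^{t}(v)=\mathsf{comb}_{t}\Big(\xi^{t-1}(v),\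 \sum_{w\in N_G(v)}\xi^{t-1}(w)\Big),\qquad 1\le t\le T,$$ with real-valued output $\xi(G,v)=\xi^T(v)\in\mathbb{R}$. It expresses a query $Q$ uniformly over all graphs if there is a real $\epsilon<\frac12$ such that for all graphs $G$ and all $v\in V(G)$: $\xi(G,v)\ge 1-\epsilon$ if $v\in Q(G)$, and $\xi(G,v)\le\epsilon$ if $v\notin Q(G)$. Then there is a GC2 query $Q$ such that no GNN with activation $\sigma$ expresses $Q$ uniformly over all graphs. -/

import Mathlib

/-! ## Vertex-labeled graphs -/

/-- A finite, undirected, simple graph whose vertices are labeled by `ℓ` colors, each vertex having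
exactly one color. -/
structure LabeledGraph (ℓ : ℕ) where
  /-- The vertices. -/
  V : Type
  /-- There are finitely many vertices. -/
  [fin : Fintype V]
  /-- The edge relation. -/
  graph : SimpleGraph V
  /-- The color of each vertex. -/
  color : V → Fin ℓ

attribute [instance] LabeledGraph.fin

/-- A unary query over graphs with `ℓ` colors: it selects a set of vertices of each graph. -/
def UnaryQuery (ℓ : ℕ) : Type 1 := (G : LabeledGraph ℓ) → Set G.V

/-! ## The logic GC2 (graded modal logic) -/

/-- The formulas of GC2 with one free variable, over `ℓ` colors. -/
inductive GC2Formula (ℓ : ℕ) : Type where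
  /-- `Col_i(x)` -/
  | col (i : Fin ℓ) : GC2Formula ℓ
  /-- `¬ φ(x)` -/
  | neg (φ : GC2Formula ℓ) : GC2Formula ℓ
  /-- `φ(x) ∧ ψ(x)` -/
  | and (φ ψ : GC2Formula ℓ) : GC2Formula ℓ
  /-- `∃^{≥ N} y (E(x, y) ∧ φ(y))`, with `N` a positive integer -/
  | existsGE (N : ℕ) (hN : 0 < N) (φ : GC2Formula ℓ) : GC2Formula ℓ

/-- `φ.Sat G v`: the formula `φ` holds in `G` at the vertex `v`. -/
def GC2Formula.Sat {ℓ : ℕ} (G : LabeledGraph ℓ) : GC2Formula ℓ → G.V → Prop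
  | .col i, v => G.color v = i
  | .neg φ, v => ¬ φ.Sat G v
  | .and φ ψ, v => φ.Sat G v ∧ ψ.Sat G v
  | .existsGE N _ φ, v => N ≤ {w : G.V | G.graph.Adj v w ∧ φ.Sat G w}.ncard

/-- A GC2 query is a unary query that is defined by a GC2 formula. -/
def IsGC2Query {ℓ : ℕ} (Q : UnaryQuery ℓ) : Prop :=
  ∃ φ : GC2Formula ℓ, ∀ (G : LabeledGraph ℓ) (v : G.V), v ∈ Q G ↔ φ.Sat G v

/-! ## Neural networks -/

/-- The parameters of a feedforward neural network from `ℝ^m` to `ℝ^n`, with any number `k ≥ 0` of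
hidden layers: `k + 1` affine maps `T₁, …, T_{k+1}`, listed from the input side. -/
inductive NeuralNetwork : ℕ → ℕ → Type where
  /-- No (further) hidden layer: the last affine map. -/
  | output {m n : ℕ} (T : (Fin m → ℝ) →ᵃ[ℝ] (Fin n → ℝ)) : NeuralNetwork m n
  /-- A hidden layer of width `w`, entered by the affine map `T`, followed by the rest. -/
  | hidden {m w n : ℕ} (T : (Fin m → ℝ) →ᵃ[ℝ] (Fin w → ℝ)) (rest : NeuralNetwork w n) :
      NeuralNetwork m n

/-- The function `T_{k+1} ∘ σ ∘ T_k ∘ ⋯ ∘ σ ∘ T₁` computed by a neural network with activation `σ`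
(applied to each coordinate). -/
def NeuralNetwork.eval (σ : ℝ → ℝ) {m n : ℕ} : NeuralNetwork m n → (Fin m → ℝ) → (Fin n → ℝ)
  | .output T, x => T x
  | .hidden T rest, x => rest.eval σ (fun i => σ (T x i))

/-! ## Graph neural networks -/

/-- The parameters of an aggregation-combine graph neural network with sum aggregation, on graphs
with `ℓ` colors and with output dimension `d`: a sequence of `T ≥ 1` combination functions, each of
them a neural network. The combination function of an iteration reads the current vector of a vertex
and the sum of the current vectors of its neighbors, both of the same dimension. -/
inductive GNN (ℓ : ℕ) : ℕ → Type where
  /-- The first iteration. -/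
  | first {d : ℕ} (comb : NeuralNetwork (ℓ + ℓ) d) : GNN ℓ d
  /-- One more iteration. -/
  | step {d e : ℕ} (prev : GNN ℓ d) (comb : NeuralNetwork (d + d) e) : GNN ℓ e

/-- The initial embedding `ξ⁰`: the indicator vector of the color of the vertex. -/
def initialEmbedding {ℓ : ℕ} (G : LabeledGraph ℓ) (v : G.V) : Fin ℓ → ℝ :=
  Pi.single (G.color v) 1

open Classical in
/-- One iteration `v ↦ comb (ξ(v), ∑_{w ∈ N(v)} ξ(w))`. -/
noncomputable def updateEmbedding (σ : ℝ → ℝ) {ℓ d e : ℕ} (G : LabeledGraph ℓ)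
    (comb : NeuralNetwork (d + d) e) (ξ : G.V → Fin d → ℝ) (v : G.V) : Fin e → ℝ :=
  comb.eval σ (Fin.append (ξ v) (∑ w ∈ G.graph.neighborFinset v, ξ w))

/-- The vertex embedding computed by a GNN with activation `σ`. -/
noncomputable def GNN.embedding (σ : ℝ → ℝ) {ℓ : ℕ} (G : LabeledGraph ℓ) :
    {d : ℕ} → GNN ℓ d → G.V → Fin d → ℝ
  | _, .first comb => updateEmbedding σ G comb (initialEmbedding G)
  | _, .step prev comb => updateEmbedding σ G comb (prev.embedding σ G)

/-! ## Expressing a query -/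

/-- The GNN `N` with activation `σ`, whose output is a real number, expresses the unary query `Q`
over the set `X` of graphs. -/
def GNN.Expresses (σ : ℝ → ℝ) {ℓ : ℕ} (N : GNN ℓ 1) (Q : UnaryQuery ℓ)
    (X : Set (LabeledGraph ℓ)) : Prop :=
  ∃ ε : ℝ, ε < 1 / 2 ∧ ∀ G ∈ X, ∀ v : G.V,
    (v ∈ Q G → 1 - ε ≤ N.embedding σ G v 0) ∧ (v ∉ Q G → N.embedding σ G v 0 ≤ ε)

/-- Uniform expressivity: over all graphs. -/
def GNN.ExpressesUniformly (σ : ℝ → ℝ) {ℓ : ℕ} (N : GNN ℓ 1) (Q : UnaryQuery ℓ) : Prop :=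
  N.Expresses σ Q Set.univ

/-! The query asks for a neighbor that has no neighbor of degree two. The test graphs are trees
(plus isolated vertices): a root with `n + 1` children, each carrying `K` bundles. In `n` of the
children exactly `k` bundles are red; the remaining child has `k` red bundles or none, according to
a flag. A red bundle gives its child neighbors of degree two, a blue one does not, so for `1 ≤ k`
and `2 ≤ n` the query holds at the root exactly when the last child has no red bundle.

No GNN detects this as `n → ∞`. Up to errors smaller than every power of `n`, the value at a vertex
below a child with `x` red bundles is a local term depending on `(x, K)` plus a response to the
root, polynomial in `n`. The response does not depend on `x`, because both kinds of bundle have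
equally many closed walks of each length at their points of attachment (`BalancedResp.respSum`);
this matters because layers without activation let the root signal travel down the bundles and back.
The root sees `n F(k, K, n) + F(x, K, n)`, with `x` the red count of the last child. If `F` is not
identically zero and its leading coefficient does not vanish at `(k, K)`, the first summand
dominates whatever `x` is, and the activation saturates to the same limit in both cases. If `F = 0`,
nothing about `x` arrives. Either way an activation erases the responses (`HasExpansion.sigmoid`),
and the final output cannot separate the flags (`HasExpansion.not_separates`).

It remains to exclude accidental zeros: a coefficient that is not identically zero must be nonzero
at suitable integers `(k, K)`. The coefficients are built from polynomials and sigmoids, and in each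
variable they lie in a ring whose nonzero elements have no zeros near `+∞`
(`exists_isTame_sigmoid`). Such a ring comes from Zorn's lemma, and Rolle's theorem shows that
adjoining an exponential preserves the property (`PolyIn.zero_or`). -/

open Filter Topology

/-! ## Tame rings of functions of one variable -/

/-- A ring of real-analytic functions that is closed under differentiation and all of whose
nonzero elements are eventually nonvanishing at `+∞`. -/
structure IsTame (R : Subring (ℝ → ℝ)) : Prop where
  analytic : ∀ f ∈ R, AnalyticOnNhd ℝ f Set.univ
  deriv_mem : ∀ f ∈ R, deriv f ∈ R
  zero_or : ∀ f ∈ R, f = 0 ∨ ∀ᶠ x in atTop, f x ≠ 0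

theorem AnalyticOnNhd.differentiable_of_univ {f : ℝ → ℝ} (hf : AnalyticOnNhd ℝ f Set.univ) :
    Differentiable ℝ f := fun x => (hf x trivial).differentiableAt

theorem AnalyticOnNhd.eq_of_eventuallyEq_atTop {f g : ℝ → ℝ} (hf : AnalyticOnNhd ℝ f Set.univ)
    (hg : AnalyticOnNhd ℝ g Set.univ) (h : ∀ᶠ x in atTop, f x = g x) : f = g := by
  obtain ⟨b, hb⟩ := eventually_atTop.1 h
  refine hf.eq_of_eventuallyEq hg (z₀ := b + 1) ?_
  filter_upwards [lt_mem_nhds (show b < b + 1 by linarith)] with x hx using hb x hx.le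

/-- The functions that are polynomials of degree at most `d` in `w` with coefficients in `R`. -/
def PolyIn (R : Subring (ℝ → ℝ)) (w : ℝ → ℝ) : ℕ → (ℝ → ℝ) → Prop
  | 0, f => f ∈ R
  | d + 1, f => ∃ a ∈ R, ∃ g, PolyIn R w d g ∧ f = a + w * g

namespace PolyIn

variable {R : Subring (ℝ → ℝ)} {w : ℝ → ℝ}

theorem of_mem {f : ℝ → ℝ} (hf : f ∈ R) : ∀ d, PolyIn R w d f
  | 0 => hf
  | d + 1 => ⟨f, hf, 0, of_mem R.zero_mem d, by simp⟩

theorem add {d : ℕ} : ∀ {f g : ℝ → ℝ}, PolyIn R w d f → PolyIn R w d g → PolyIn R w d (f + g) := by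
  induction d with
  | zero => exact fun hf hg => R.add_mem hf hg
  | succ d ih =>
    rintro f g ⟨a, ha, f', hf, rfl⟩ ⟨b, hb, g', hg, rfl⟩
    exact ⟨a + b, R.add_mem ha hb, f' + g', ih hf hg, by ring⟩

theorem mem_mul {a : ℝ → ℝ} (ha : a ∈ R) {d : ℕ} :
    ∀ {f : ℝ → ℝ}, PolyIn R w d f → PolyIn R w d (a * f) := by
  induction d with
  | zero => exact fun hf => R.mul_mem ha hf
  | succ d ih =>
    rintro f ⟨b, hb, f', hf, rfl⟩
    exact ⟨a * b, R.mul_mem ha hb, a * f', ih hf, by ring⟩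

theorem neg {d : ℕ} {f : ℝ → ℝ} (hf : PolyIn R w d f) : PolyIn R w d (-f) := by
  simpa using mem_mul (R.neg_mem R.one_mem) hf

theorem succ {d : ℕ} : ∀ {f : ℝ → ℝ}, PolyIn R w d f → PolyIn R w (d + 1) f := by
  induction d with
  | zero => exact fun hf => of_mem hf 1
  | succ d ih =>
    rintro f ⟨b, hb, f', hf, rfl⟩
    exact ⟨b, hb, f', ih hf, rfl⟩

theorem mono {d e : ℕ} (h : d ≤ e) {f : ℝ → ℝ} (hf : PolyIn R w d f) : PolyIn R w e f := by
  induction h with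
  | refl => exact hf
  | step _ ih => exact ih.succ

theorem mul {d e : ℕ} {g : ℝ → ℝ} (hg : PolyIn R w e g) :
    ∀ {f : ℝ → ℝ}, PolyIn R w d f → PolyIn R w (d + e) (f * g) := by
  induction d with
  | zero => intro f hf; simpa using mem_mul hf hg
  | succ d ih =>
    rintro f ⟨b, hb, f', hf, rfl⟩
    have h1 : PolyIn R w (d + 1 + e) (b * g) := (mem_mul hb hg).mono (by omega)
    have h2 : PolyIn R w (d + 1 + e) (w * (f' * g)) := by
      rw [show d + 1 + e = (d + e) + 1 by omega]
      exact ⟨0, R.zero_mem, _, ih hf, by simp⟩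
    have := h1.add h2
    rwa [show b * g + w * (f' * g) = (b + w * f') * g by ring] at this

theorem analytic (hR : IsTame R) (hw : AnalyticOnNhd ℝ w Set.univ) {d : ℕ} :
    ∀ {f : ℝ → ℝ}, PolyIn R w d f → AnalyticOnNhd ℝ f Set.univ := by
  induction d with
  | zero => exact fun hf => hR.analytic _ hf
  | succ d ih =>
    rintro f ⟨b, hb, f', hf, rfl⟩
    exact (hR.analytic _ hb).add (hw.mul (ih hf))

/-- Since `w'` is a multiple of `w` by an element of `R`, differentiation does not raise the degree
in `w`. -/
theorem deriv_mem (hR : IsTame R) (hw : AnalyticOnNhd ℝ w Set.univ) {u' : ℝ → ℝ} (hu' : u' ∈ R)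
    (hw' : deriv w = u' * w) {d : ℕ} :
    ∀ {f : ℝ → ℝ}, PolyIn R w d f → PolyIn R w d (deriv f) := by
  induction d with
  | zero => exact fun hf => hR.deriv_mem _ hf
  | succ d ih =>
    rintro f ⟨b, hb, f', hf, rfl⟩
    refine ⟨deriv b, hR.deriv_mem _ hb, u' * f' + deriv f', (mem_mul hu' hf).add (ih hf), ?_⟩
    have hb' := (hR.analytic _ hb).differentiable_of_univ
    have hf' := (hf.analytic hR hw).differentiable_of_univ
    have hw2 := hw.differentiable_of_univ
    ext x
    rw [deriv_add (hb' x) ((hw2 x).mul (hf' x)), deriv_mul (hw2 x) (hf' x), hw']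
    simp only [Pi.add_apply, Pi.mul_apply]
    ring

/-- Induction on the degree in `w`. Dividing by the constant coefficient and differentiating kills
that coefficient, and a factor `w`, which never vanishes, can then be dropped; Rolle's theorem
carries the information back. -/
theorem zero_or (hR : IsTame R) (hw : AnalyticOnNhd ℝ w Set.univ) {u' : ℝ → ℝ} (hu' : u' ∈ R)
    (hw' : deriv w = u' * w) (hw0 : ∀ x, w x ≠ 0) {d : ℕ} :
    ∀ {f : ℝ → ℝ}, PolyIn R w d f → f = 0 ∨ ∀ᶠ x in atTop, f x ≠ 0 := by
  induction d with
  | zero => exact fun hf => hR.zero_or _ hf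
  | succ d ih =>
    rintro f ⟨a, ha, g, hg, rfl⟩
    have hga := hg.analytic hR hw
    have haa := hR.analytic _ ha
    have hgd := hga.differentiable_of_univ
    have had := haa.differentiable_of_univ
    have hwd := hw.differentiable_of_univ
    rcases hR.zero_or _ ha with rfl | ha0
    · rcases ih hg with rfl | h
      · left; simp
      · right
        filter_upwards [h] with x hx
        simpa using ⟨hw0 x, hx⟩
    set f := a + w * g with hf
    have hfa : AnalyticOnNhd ℝ f Set.univ := haa.add (hw.mul hga)
    have hfd := hfa.differentiable_of_univ
    -- This is the numerator of `(f / a)'` with the factor `w` removed; it has degree at most `d`,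
    -- so the induction hypothesis applies.
    set q := a * (u' * g + deriv g) + -(deriv a * g) with hq
    have hqP : PolyIn R w d q :=
      (mem_mul ha ((mem_mul hu' hg).add (hg.deriv_mem hR hw hu' hw'))).add
        (mem_mul (hR.deriv_mem _ ha) hg).neg
    have hder : ∀ x, a x ≠ 0 → HasDerivAt (fun x => f x / a x) (w x * q x / a x ^ 2) x := by
      intro x hx
      have h1 : HasDerivAt f (deriv a x + (u' x * w x * g x + w x * deriv g x)) x := by
        have h2 := (had x).hasDerivAt.add ((hwd x).hasDerivAt.mul (hgd x).hasDerivAt)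
        rwa [hw'] at h2
      refine (h1.div (had x).hasDerivAt hx).congr_deriv ?_
      congr 1
      simp only [hf, hq, Pi.add_apply, Pi.mul_apply, Pi.neg_apply]
      ring
    rcases ih hqP with hq0 | hq0
    -- Here `f / a` is constant near `+∞`, and analyticity extends `f = c * a` to the whole line.
    · obtain ⟨b, hb⟩ := eventually_atTop.1 ha0
      have hconst : ∀ x ∈ Set.Ioi b, f x / a x = f (b + 1) / a (b + 1) := by
        intro x hx
        refine (isOpen_Ioi (a := b)).is_const_of_deriv_eq_zero isPreconnected_Ioi
          (f := fun x => f x / a x)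
          (fun y hy => ((hder y (hb y (le_of_lt hy))).differentiableAt).differentiableWithinAt)
          (fun y hy => ?_) hx (by simp : b + 1 ∈ Set.Ioi b)
        rw [(hder y (hb y (le_of_lt hy))).deriv, hq0]
        simp
      set c := f (b + 1) / a (b + 1)
      have hfc : f = fun x => c * a x := by
        refine hfa.eq_of_eventuallyEq_atTop (analyticOnNhd_const.mul haa) ?_
        filter_upwards [eventually_gt_atTop b] with x hx
        rw [← hconst x hx, div_mul_cancel₀ _ (hb x hx.le)]
      by_cases hc : c = 0
      · left; rw [hfc, hc]; ext x; simp
      · right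
        filter_upwards [ha0] with x hx
        rw [hfc]
        exact mul_ne_zero hc hx
    · right
      obtain ⟨b, hb⟩ := eventually_atTop.1 (ha0.and hq0)
      -- Two zeros of `f` beyond `b` would force a zero of `(f / a)'` between them, so there is at
      -- most one.
      have hinj : ∀ x y, b ≤ x → x < y → f x = 0 → f y ≠ 0 := by
        intro x y hx hxy hfx hfy
        obtain ⟨z, hz, hz'⟩ := exists_hasDerivAt_eq_zero (f := fun x => f x / a x)
          (f' := fun x => w x * q x / a x ^ 2) hxy
          (fun t ht => (hder t (hb t (hx.trans ht.1)).1).continuousAt.continuousWithinAt)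
          (by simp [hfx, hfy])
          (fun t ht => hder t (hb t (hx.trans ht.1.le)).1)
        have h3 := hb z (hx.trans hz.1.le)
        exact div_ne_zero (mul_ne_zero (hw0 z) h3.2) (pow_ne_zero 2 h3.1) hz'
      by_cases h : ∃ x, b ≤ x ∧ f x = 0
      · obtain ⟨x, hx, hfx⟩ := h
        filter_upwards [eventually_gt_atTop x] with y hy using hinj x y hx hy hfx
      · push Not at h
        filter_upwards [eventually_ge_atTop b] with y hy using h y hy

end PolyIn

/-- The ring obtained from `R` by adjoining `w`. -/
def Subring.adjoinFun (R : Subring (ℝ → ℝ)) (w : ℝ → ℝ) : Subring (ℝ → ℝ) where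
  carrier := {f | ∃ d, PolyIn R w d f}
  zero_mem' := ⟨0, R.zero_mem⟩
  one_mem' := ⟨0, R.one_mem⟩
  add_mem' := by
    rintro f g ⟨d, hf⟩ ⟨e, hg⟩
    exact ⟨d + e, (hf.mono (by omega)).add (hg.mono (by omega))⟩
  mul_mem' := by
    rintro f g ⟨d, hf⟩ ⟨e, hg⟩
    exact ⟨d + e, hg.mul hf⟩
  neg_mem' := by
    rintro f ⟨d, hf⟩
    exact ⟨d, hf.neg⟩

theorem IsTame.adjoin_exp {R : Subring (ℝ → ℝ)} (hR : IsTame R) {u : ℝ → ℝ} (hu : u ∈ R) :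
    IsTame (R.adjoinFun fun x => Real.exp (u x)) := by
  have hua := hR.analytic _ hu
  have hw : AnalyticOnNhd ℝ (fun x => Real.exp (u x)) Set.univ := hua.rexp
  have hw' : deriv (fun x => Real.exp (u x)) = deriv u * fun x => Real.exp (u x) := by
    ext x
    rw [((hua.differentiable_of_univ x).hasDerivAt.exp).deriv, Pi.mul_apply, mul_comm]
  have hu' := hR.deriv_mem _ hu
  refine ⟨?_, ?_, ?_⟩
  · rintro f ⟨d, hf⟩; exact hf.analytic hR hw
  · rintro f ⟨d, hf⟩; exact ⟨d, hf.deriv_mem hR hw hu' hw'⟩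
  · rintro f ⟨d, hf⟩; exact hf.zero_or hR hw hu' hw' fun x => (Real.exp_pos _).ne'

/-- The analytic functions that become elements of `R` after multiplication by a power of `v`. -/
def Subring.awayFun (R : Subring (ℝ → ℝ)) (v : ℝ → ℝ) (hv : v ∈ R) : Subring (ℝ → ℝ) where
  carrier := {f | AnalyticOnNhd ℝ f Set.univ ∧ ∃ d : ℕ, v ^ d * f ∈ R}
  zero_mem' := ⟨analyticOnNhd_const, 0, by simp⟩
  one_mem' := ⟨analyticOnNhd_const, 0, by simp⟩
  add_mem' := by
    rintro f g ⟨hf, d, hfd⟩ ⟨hg, e, hge⟩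
    refine ⟨hf.add hg, d + e, ?_⟩
    rw [show v ^ (d + e) * (f + g) = v ^ e * (v ^ d * f) + v ^ d * (v ^ e * g) by ring]
    exact R.add_mem (R.mul_mem (R.pow_mem hv _) hfd) (R.mul_mem (R.pow_mem hv _) hge)
  mul_mem' := by
    rintro f g ⟨hf, d, hfd⟩ ⟨hg, e, hge⟩
    refine ⟨hf.mul hg, d + e, ?_⟩
    rw [show v ^ (d + e) * (f * g) = (v ^ d * f) * (v ^ e * g) by ring]
    exact R.mul_mem hfd hge
  neg_mem' := by
    rintro f ⟨hf, d, hfd⟩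
    refine ⟨hf.neg, d, ?_⟩
    rw [mul_neg]
    exact R.neg_mem hfd

/-- Multiplication by a power of the nonvanishing `v` does not change zeros. Closure under
differentiation is the quotient rule with denominators cleared, at the cost of one more power of
`v`. -/
theorem IsTame.away {R : Subring (ℝ → ℝ)} (hR : IsTame R) {v : ℝ → ℝ} (hv : v ∈ R)
    (hv0 : ∀ x, v x ≠ 0) : IsTame (R.awayFun v hv) := by
  refine ⟨fun f hf => hf.1, ?_, ?_⟩
  · rintro f ⟨hf, d, hfd⟩
    refine ⟨fun x hx => (hf x hx).deriv, d + 1, ?_⟩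
    have hvd := (hR.analytic _ hv).differentiable_of_univ
    have hfd' := hf.differentiable_of_univ
    have key : v ^ (d + 1) * deriv f
        = v * deriv (v ^ d * f) - ((d : ℕ) : ℝ → ℝ) * (deriv v * (v ^ d * f)) := by
      ext x
      have h1 := (((hvd x).hasDerivAt.pow d).mul (hfd' x).hasDerivAt).deriv
      simp only [Pi.sub_apply, Pi.mul_apply, Pi.pow_apply, Pi.natCast_apply]
      rw [h1]
      rcases d with _ | d
      · simp
      · simp only [Pi.pow_apply, Nat.add_sub_cancel]; ring
    rw [key]
    exact R.sub_mem (R.mul_mem hv (hR.deriv_mem _ hfd))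
      (R.mul_mem (natCast_mem R d) (R.mul_mem (hR.deriv_mem _ hv) hfd))
  · rintro f ⟨hf, d, hfd⟩
    rcases hR.zero_or _ hfd with h | h
    · left
      ext x
      have := congrFun h x
      simpa [hv0 x] using this
    · right
      filter_upwards [h] with x hx hfx
      exact hx (by simp [hfx])

/-- The ring of polynomial functions. -/
noncomputable def polyFunRing : Subring (ℝ → ℝ) :=
  (RingHom.pi fun x : ℝ => Polynomial.evalRingHom x).range

theorem mem_polyFunRing {f : ℝ → ℝ} :
    f ∈ polyFunRing ↔ ∃ p : Polynomial ℝ, f = fun x => p.eval x := by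
  constructor
  · rintro ⟨p, rfl⟩; exact ⟨p, rfl⟩
  · rintro ⟨p, rfl⟩; exact ⟨p, rfl⟩

theorem isTame_polyFunRing : IsTame polyFunRing := by
  refine ⟨?_, ?_, ?_⟩ <;> intro f hf <;> obtain ⟨p, rfl⟩ := mem_polyFunRing.1 hf
  · exact AnalyticOnNhd.eval_polynomial p
  · exact mem_polyFunRing.2 ⟨p.derivative, by ext x; simp⟩
  · by_cases hp : p = 0
    · left; ext x; simp [hp]
    · right; exact p.eventually_atTop_not_isRoot hp

/-- There is a tame ring that contains the constants and the identity and is closed under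
composition with the sigmoid function. -/
theorem exists_isTame_sigmoid : ∃ R : Subring (ℝ → ℝ), IsTame R ∧ (∀ c : ℝ, (fun _ => c) ∈ R) ∧
    (fun x => x) ∈ R ∧ ∀ u ∈ R, (fun x => Real.sigmoid (u x)) ∈ R := by
  -- Every condition in `IsTame` concerns one function at a time, so the union of a chain of tame
  -- rings is tame.
  obtain ⟨R, hPR, hR⟩ := zorn_le_nonempty₀ {R : Subring (ℝ → ℝ) | IsTame R} (by
    intro c hc hchain R₀ hR₀
    have hmem : ∀ f, f ∈ sSup c ↔ ∃ s ∈ c, f ∈ s := fun f =>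
      Subring.mem_sSup_of_directedOn ⟨R₀, hR₀⟩ hchain.directedOn
    refine ⟨sSup c, ⟨?_, ?_, ?_⟩, fun s hs => le_sSup hs⟩ <;> intro f hf <;>
      obtain ⟨s, hs, hfs⟩ := (hmem f).1 hf
    · exact (hc hs).analytic f hfs
    · exact (hmem _).2 ⟨s, hs, (hc hs).deriv_mem f hfs⟩
    · exact (hc hs).zero_or f hfs) polyFunRing isTame_polyFunRing
  have hT : IsTame R := hR.prop
  refine ⟨R, hT, fun c => hPR (mem_polyFunRing.2 ⟨.C c, by simp⟩),
    hPR (mem_polyFunRing.2 ⟨.X, by simp⟩), fun u hu => ?_⟩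
  -- By maximality, adjoining `exp (-u)` adds nothing; it is the polynomial `0 + w * 1` of degree
  -- one.
  have hexp : (fun x => Real.exp ((-u) x)) ∈ R :=
    hR.le_of_ge (hT.adjoin_exp (R.neg_mem hu)) (fun f hf => ⟨0, hf⟩)
      ⟨1, 0, R.zero_mem, 1, R.one_mem, by simp⟩
  have hv : (1 + fun x => Real.exp ((-u) x)) ∈ R := R.add_mem R.one_mem hexp
  have hpos : ∀ x, (1 + fun x => Real.exp ((-u) x)) x ≠ 0 := fun x => by
    simp only [Pi.add_apply, Pi.one_apply]; positivity
  -- Maximality again: the sigmoid of `u` is the inverse of `1 + exp (-u)`, so one power of this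
  -- denominator brings it to `1`.
  refine hR.le_of_ge (hT.away hv hpos) (fun f hf => ⟨hT.analytic f hf, 0, by simpa using hf⟩) ?_
  refine ⟨fun x hx => ((hT.analytic u hu) x hx).sigmoid', 1, ?_⟩
  convert R.one_mem using 1
  ext x
  have := hpos x
  simp only [Pi.add_apply, Pi.one_apply, Pi.neg_apply] at this
  simp [Real.sigmoid_def, mul_inv_cancel₀ this]

/-! ## Functions of two variables that are tame in each of them -/

/-- The functions of two variables that belong to `R` in each variable. -/
def biRing (R : Subring (ℝ → ℝ)) : Subring (ℝ → ℝ → ℝ) where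
  carrier := {f | (∀ x, (fun y => f x y) ∈ R) ∧ ∀ y, (fun x => f x y) ∈ R}
  zero_mem' := ⟨fun _ => R.zero_mem, fun _ => R.zero_mem⟩
  one_mem' := ⟨fun _ => R.one_mem, fun _ => R.one_mem⟩
  add_mem' hf hg := ⟨fun x => R.add_mem (hf.1 x) (hg.1 x), fun y => R.add_mem (hf.2 y) (hg.2 y)⟩
  mul_mem' hf hg := ⟨fun x => R.mul_mem (hf.1 x) (hg.1 x), fun y => R.mul_mem (hf.2 y) (hg.2 y)⟩
  neg_mem' hf := ⟨fun x => R.neg_mem (hf.1 x), fun y => R.neg_mem (hf.2 y)⟩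

/-- Evaluation at a point. -/
def biRing.ev {R : Subring (ℝ → ℝ)} (x y : ℝ) : biRing R →+* ℝ where
  toFun f := f.1 x y
  map_zero' := rfl
  map_one' := rfl
  map_add' _ _ := rfl
  map_mul' _ _ := rfl

theorem IsTame.eventually_ne_zero {R : Subring (ℝ → ℝ)} (hR : IsTame R) {f : ℝ → ℝ} (hf : f ∈ R)
    {x : ℝ} (hx : f x ≠ 0) : ∀ᶠ n : ℕ in atTop, f n ≠ 0 := by
  rcases hR.zero_or f hf with rfl | h
  · exact absurd rfl hx
  · exact tendsto_natCast_atTop_atTop.eventually h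

/-- From a nonzero value at `(x, y)`, first `x` is moved to a large integer `k` with `y` fixed, then
`y` to an integer `K` that is large depending on `k`. This order of choice is the reason for the
curried filter. -/
theorem biRing.eventually_ne_zero {R : Subring (ℝ → ℝ)} (hR : IsTame R) {f : biRing R}
    (hf : f ≠ 0) :
    ∀ᶠ q : ℕ × ℕ in (atTop : Filter ℕ).curry atTop, biRing.ev (q.1 : ℝ) (q.2 : ℝ) f ≠ 0 := by
  obtain ⟨x, y, hxy⟩ : ∃ x y, f.1 x y ≠ 0 := by
    by_contra! h
    exact hf (Subtype.ext (funext fun x => funext fun y => h x y))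
  rw [eventually_curry_iff]
  filter_upwards [hR.eventually_ne_zero (f.2.2 y) hxy] with k hk
  exact hR.eventually_ne_zero (f.2.1 k) hk

/-! ## Superpolynomially small sequences -/

/-- The sequence decays faster than any power of its index. -/
def Negl (f : ℕ → ℝ) : Prop := Asymptotics.SuperpolynomialDecay atTop (fun n : ℕ => (n : ℝ)) f

namespace Negl

theorem zero : Negl fun _ => 0 := Asymptotics.superpolynomialDecay_zero _ _

theorem add {f g : ℕ → ℝ} (hf : Negl f) (hg : Negl g) : Negl fun n => f n + g n :=
  Asymptotics.SuperpolynomialDecay.add hf hg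

theorem const_mul {f : ℕ → ℝ} (c : ℝ) (hf : Negl f) : Negl fun n => c * f n :=
  Asymptotics.SuperpolynomialDecay.const_mul hf c

theorem natCast_mul {f : ℕ → ℝ} (hf : Negl f) : Negl fun n => (n : ℝ) * f n :=
  Asymptotics.SuperpolynomialDecay.param_mul hf

theorem tendsto {f : ℕ → ℝ} (hf : Negl f) : Tendsto f atTop (𝓝 0) := by
  simpa using hf 0

theorem of_abs_le {f g : ℕ → ℝ} (hf : Negl f) (h : ∀ᶠ n in atTop, |g n| ≤ |f n|) : Negl g :=
  Asymptotics.SuperpolynomialDecay.trans_eventually_abs_le hf h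

theorem congr {f g : ℕ → ℝ} (hf : Negl f) (h : ∀ n, f n = g n) : Negl g := by
  rwa [← funext h]

theorem exp_neg {δ : ℝ} (hδ : 0 < δ) : Negl fun n => Real.exp (-(δ * n)) := by
  intro m
  have h := (tendsto_natCast_atTop_atTop (R := ℝ)).const_mul_atTop hδ
  have h1 := ((Real.tendsto_pow_mul_exp_neg_atTop_nhds_zero m).comp h).const_mul ((δ ^ m)⁻¹)
  rw [mul_zero] at h1
  refine h1.congr fun _ => ?_
  simp only [Function.comp, mul_pow]
  field_simp

end Negl

theorem Real.abs_sigmoid_sub_le (x y : ℝ) : |Real.sigmoid x - Real.sigmoid y| ≤ |x - y| := by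
  have h := Convex.norm_image_sub_le_of_norm_deriv_le (f := Real.sigmoid) (s := Set.univ) (C := 1)
    (x := y) (y := x) (fun z _ => differentiableAt_sigmoid) (fun z _ => ?_) convex_univ trivial
    trivial
  · simpa using h
  · rw [Real.deriv_sigmoid, Real.norm_eq_abs, abs_le]
    have h1 := Real.sigmoid_pos z
    have h2 := Real.sigmoid_lt_one z
    constructor <;> nlinarith

theorem Negl.sigmoid_sub {z w : ℕ → ℝ} (h : Negl fun n => z n - w n) :
    Negl fun n => Real.sigmoid (z n) - Real.sigmoid (w n) :=
  h.of_abs_le (Eventually.of_forall fun _ => Real.abs_sigmoid_sub_le _ _)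

theorem Negl.sigmoid_of_le {z : ℕ → ℝ} {δ : ℝ} (hδ : 0 < δ) (h : ∀ᶠ n : ℕ in atTop, z n ≤ -(δ * n)) :
    Negl fun n => Real.sigmoid (z n) := by
  refine (Negl.exp_neg hδ).of_abs_le ?_
  filter_upwards [h] with n hn
  rw [abs_of_pos (Real.sigmoid_pos _), abs_of_pos (Real.exp_pos _), Real.sigmoid_def]
  refine le_trans ?_ (Real.exp_le_exp.2 hn)
  rw [← inv_inv (Real.exp (z n)), ← Real.exp_neg]
  gcongr
  linarith

theorem Polynomial.eventually_linear_le_eval {q : Polynomial ℝ} (hd : 0 < q.natDegree)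
    (hl : 0 < q.leadingCoeff) :
    ∀ᶠ n : ℕ in atTop, q.leadingCoeff / 2 * n ≤ q.eval (n : ℝ) := by
  have h := q.isEquivalent_atTop_lead.def (c := 1 / 2) (by norm_num)
  filter_upwards [tendsto_natCast_atTop_atTop.eventually h, eventually_ge_atTop 1] with n hn hn1
  have hn1' : (1 : ℝ) ≤ n := by exact_mod_cast hn1
  have h1 : (n : ℝ) ≤ (n : ℝ) ^ q.natDegree := le_self_pow₀ hn1' hd.ne'
  have h2 : 0 ≤ q.leadingCoeff * (n : ℝ) ^ q.natDegree := by positivity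
  simp only [Pi.sub_apply, Real.norm_eq_abs] at hn
  rw [abs_of_nonneg h2] at hn
  have h3 := (abs_le.1 hn).1
  nlinarith [mul_le_mul_of_nonneg_left h1 hl.le]

/-- Half of the leading coefficient pays for the lower terms of `q`, and a further quarter absorbs
`a` and the error, which is eventually above `-1`. -/
theorem eventually_linear_le_of_polynomial {q : Polynomial ℝ} (hd : 0 < q.natDegree)
    (hl : 0 < q.leadingCoeff) {a : ℝ} {z : ℕ → ℝ} (hz : Negl fun n => z n - (a + q.eval (n : ℝ))) :
    ∀ᶠ n : ℕ in atTop, q.leadingCoeff / 4 * n ≤ z n := by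
  have h1 := hz.tendsto.eventually (lt_mem_nhds (show (-1 : ℝ) < 0 by norm_num))
  have h2 := ((tendsto_natCast_atTop_atTop (R := ℝ)).const_mul_atTop
    (show 0 < q.leadingCoeff / 4 by positivity)).eventually_ge_atTop (1 - a)
  filter_upwards [h1, h2, q.eventually_linear_le_eval hd hl] with n h1 h2 h3
  linarith

theorem eventually_le_linear_of_polynomial {q : Polynomial ℝ} (hd : 0 < q.natDegree)
    (hl : q.leadingCoeff < 0) {a : ℝ} {z : ℕ → ℝ} (hz : Negl fun n => z n - (a + q.eval (n : ℝ))) :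
    ∀ᶠ n : ℕ in atTop, z n ≤ -(-q.leadingCoeff / 4 * n) := by
  have h := eventually_linear_le_of_polynomial (q := -q) (a := -a) (z := fun n => -z n)
    (by simpa using hd) (by simpa using hl)
    ((hz.const_mul (-1)).congr fun n => by simp only [Polynomial.eval_neg]; ring)
  filter_upwards [h] with n hn
  rw [Polynomial.leadingCoeff_neg] at hn
  linarith

/-! ## The class dynamics -/

/-- The kinds of vertices in the branch below a child of the root: the child itself (`hub`), the
vertices of a red path `top - mid - tip` hanging from it, and the blue gadget made of a `leaf` and of
a vertex `fork` with two leaves `prong`. -/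
inductive Pos : Type
  | hub | top | mid | tip | leaf | fork | prong

instance : Finite Pos :=
  Finite.of_surjective (![.hub, .top, .mid, .tip, .leaf, .fork, .prong] : Fin 7 → Pos) fun p => by
    cases p
    exacts [⟨0, rfl⟩, ⟨1, rfl⟩, ⟨2, rfl⟩, ⟨3, rfl⟩, ⟨4, rfl⟩, ⟨5, rfl⟩, ⟨6, rfl⟩]

/-- The kinds of vertices of the whole graph; the flag of a branch is `true` when the branch has no
red path. -/
inductive Cls : Type
  | root
  | node (p : Pos) (b : Bool)
  | isolated

/-- The number of red bundles of a branch. -/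
def redCount (k : ℕ) (b : Bool) : ℕ := if b then 0 else k

/-- The sum of `f` over the neighbors of a vertex of a given class. -/
def nbSum (k K : ℕ) (β : Bool) (n : ℕ) (f : Cls → ℝ) : Cls → ℝ
  | .root => n * f (.node .hub false) + f (.node .hub β)
  | .node .hub b => f .root + (redCount k b : ℕ) * (2 * f (.node .top b)) +
      ((K - redCount k b : ℕ) : ℝ) * (f (.node .leaf b) + f (.node .fork b))
  | .node .top b => f (.node .hub b) + f (.node .mid b)
  | .node .mid b => f (.node .top b) + f (.node .tip b)
  | .node .tip b => f (.node .mid b)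
  | .node .leaf b => f (.node .hub b)
  | .node .fork b => f (.node .hub b) + 2 * f (.node .prong b)
  | .node .prong b => f (.node .fork b)
  | .isolated => 0

/-- A real quantity attached to each class, depending on the parameters of the graph. -/
abbrev Family : Type := ℕ → ℕ → Bool → ℕ → Cls → ℝ

/-- The relations between the linear responses of the vertices of a branch which express that a red
and a blue bundle respond in the same way. -/
structure BalancedResp {A : Type*} [CommRing A] (H : Pos → A) : Prop where
  bundle : H .top + H .top = H .leaf + H .fork
  mid_eq : H .mid = H .prong
  fork_eq : H .top + H .tip = H .fork

/-- The linear responses of the neighborhoods of the vertices of a branch, where `F` is the response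
of the root and `K` is the number of bundles. -/
def respSum {A : Type*} [CommRing A] (F K : A) (H : Pos → A) : Pos → A
  | .hub => F + (K + K) * H .top
  | .top => H .hub + H .mid
  | .mid => H .top + H .tip
  | .tip => H .mid
  | .leaf => H .hub
  | .fork => H .hub + (H .prong + H .prong)
  | .prong => H .fork

namespace BalancedResp

variable {A : Type*} [CommRing A] {H H' : Pos → A}

theorem zero : BalancedResp fun _ => (0 : A) := ⟨rfl, rfl, by simp⟩

theorem add (h : BalancedResp H) (h' : BalancedResp H') : BalancedResp fun p => H p + H' p :=
  ⟨by linear_combination h.bundle + h'.bundle, by rw [h.mid_eq, h'.mid_eq],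
    by linear_combination h.fork_eq + h'.fork_eq⟩

theorem const_mul (a : A) (h : BalancedResp H) : BalancedResp fun p => a * H p :=
  ⟨by linear_combination a * h.bundle, by rw [h.mid_eq], by linear_combination a * h.fork_eq⟩

/-- Preserving `bundle` requires `mid_eq`, and `mid_eq` and `fork_eq` require each other, so the
three relations form a closed system. They encode that two paths rooted at their ends have as many
closed walks at the roots as a single vertex and a two-pronged fork rooted at its center. -/
theorem respSum (h : BalancedResp H) (F K : A) : BalancedResp (respSum F K H) := by
  refine ⟨?_, ?_, ?_⟩ <;> simp only [_root_.respSum]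
  · rw [h.mid_eq]; ring
  · exact h.fork_eq
  · rw [h.mid_eq]; ring

end BalancedResp

/-! ### Asymptotic expansions in the number of children -/

section Asymptotics

open Polynomial biRing

variable {R : Subring (ℝ → ℝ)}

/-- The sum over the children of the root of the quantity `p`, where the child of a branch with `x`
red bundles contributes `p` evaluated at `x`. -/
noncomputable def childSum (k K : ℕ) (β : Bool) (n : ℕ) (p : (biRing R)[X]) : ℝ :=
  n * p.eval₂ (ev (k : ℝ) (K : ℝ)) (n : ℝ) + p.eval₂ (ev (redCount k β : ℝ) (K : ℝ)) (n : ℝ)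

theorem childSum_zero (k K : ℕ) (β : Bool) (n : ℕ) : childSum k K β n (0 : (biRing R)[X]) = 0 := by
  simp [childSum]

theorem childSum_add (k K : ℕ) (β : Bool) (n : ℕ) (p q : (biRing R)[X]) :
    childSum k K β n (p + q) = childSum k K β n p + childSum k K β n q := by
  simp only [childSum, eval₂_add]; ring

theorem childSum_succ_mul (k K : ℕ) (β : Bool) (n : ℕ) (p : (biRing R)[X]) :
    childSum k K β n ((X + 1) * p) = (n + 1) * childSum k K β n p := by
  simp only [childSum, eval₂_mul, eval₂_add, eval₂_X, eval₂_one]; ring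

theorem childSum_C (k K : ℕ) (β : Bool) (n : ℕ) (f : biRing R) :
    childSum k K β n (C f) = n * ev (k : ℝ) (K : ℝ) f + ev (redCount k β : ℝ) (K : ℝ) f := by
  simp only [childSum, eval₂_C]

theorem childSum_C_mul (k K : ℕ) (β : Bool) (n : ℕ) (f : biRing R) (p : (biRing R)[X]) (a : ℝ)
    (hf : ∀ x : ℝ, ev x (K : ℝ) f = a) :
    childSum k K β n (C f * p) = a * childSum k K β n p := by
  simp only [childSum, eval₂_mul, eval₂_C, hf]; ring

/-- `childSum` as a polynomial in the number of children. -/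
noncomputable def childPoly (k K : ℕ) (β : Bool) (p : (biRing R)[X]) : ℝ[X] :=
  X * p.map (ev (k : ℝ) (K : ℝ)) + p.map (ev (redCount k β : ℝ) (K : ℝ))

theorem eval_childPoly (k K : ℕ) (β : Bool) (n : ℕ) (p : (biRing R)[X]) :
    (childPoly k K β p).eval (n : ℝ) = childSum k K β n p := by
  simp [childPoly, childSum, eval_map]

/-- The leading term comes from the `n` identical children; the last child contributes strictly
lower degree, so neither the degree nor the leading coefficient depends on the flag. -/
theorem childPoly_leadingCoeff {k K : ℕ} (β : Bool) {p : (biRing R)[X]}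
    (h : ev (k : ℝ) (K : ℝ) p.leadingCoeff ≠ 0) :
    0 < (childPoly k K β p).natDegree ∧
      (childPoly k K β p).leadingCoeff = ev (k : ℝ) (K : ℝ) p.leadingCoeff := by
  have h1 : (p.map (ev (k : ℝ) (K : ℝ))).natDegree = p.natDegree :=
    natDegree_map_of_leadingCoeff_ne_zero _ h
  have h2 : (p.map (ev (k : ℝ) (K : ℝ))).leadingCoeff = ev (k : ℝ) (K : ℝ) p.leadingCoeff :=
    leadingCoeff_map_of_leadingCoeff_ne_zero _ h
  have h0 : p.map (ev (k : ℝ) (K : ℝ)) ≠ 0 := by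
    rw [← leadingCoeff_ne_zero, h2]; exact h
  have h3 : (X * p.map (ev (k : ℝ) (K : ℝ))).natDegree = p.natDegree + 1 := by
    rw [natDegree_X_mul h0, h1]
  have hlt : (p.map (ev (redCount k β : ℝ) (K : ℝ))).natDegree <
      (X * p.map (ev (k : ℝ) (K : ℝ))).natDegree := by
    rw [h3]; exact Nat.lt_succ_of_le (natDegree_map_le)
  have hlt' := degree_lt_degree hlt
  constructor
  · rw [childPoly, natDegree_add_eq_left_of_natDegree_lt hlt, h3]; omega
  · rw [childPoly, leadingCoeff_add_of_degree_lt' hlt', leadingCoeff_mul, leadingCoeff_X, one_mul, h2]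

variable (U : Ultrafilter (ℕ × ℕ))

/-- Every nonzero function of the ring is nonzero at almost all parameters. -/
def IsGeneric (R : Subring (ℝ → ℝ)) (U : Ultrafilter (ℕ × ℕ)) : Prop :=
  ∀ f : biRing R, f ≠ 0 → ∀ᶠ q in (U : Filter (ℕ × ℕ)), ev (q.1 : ℝ) (q.2 : ℝ) f ≠ 0

variable {U}

/-- An ultrafilter decides which sign a generically nonzero function has. -/
theorem IsGeneric.pos_or_neg (hU : IsGeneric R U) {f : biRing R} (hf : f ≠ 0) :
    (∀ᶠ q in (U : Filter (ℕ × ℕ)), 0 < ev (q.1 : ℝ) (q.2 : ℝ) f) ∨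
      ∀ᶠ q in (U : Filter (ℕ × ℕ)), ev (q.1 : ℝ) (q.2 : ℝ) f < 0 := by
  rw [← Ultrafilter.eventually_or]
  filter_upwards [hU f hf] with q hq using (lt_or_gt_of_ne hq).symm

/-- The sign of the leading coefficient is fixed along `U`, so the argument of the sigmoid grows at
least linearly towards `+∞` or `-∞`. The limit `s` depends neither on the flag nor on the local term
`a`, and the error is exponentially small in `n`. -/
theorem IsGeneric.exists_saturation (hU : IsGeneric R U) {p : (biRing R)[X]} (hp : p ≠ 0) :
    ∃ s : ℝ, ∀ᶠ q in (U : Filter (ℕ × ℕ)), ∀ (β : Bool) (a : ℝ) (z : ℕ → ℝ),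
      (Negl fun n => z n - (a + childSum q.1 q.2 β n p)) →
        Negl fun n => Real.sigmoid (z n) - s := by
  rcases hU.pos_or_neg (leadingCoeff_ne_zero.2 hp) with h | h
  · refine ⟨1, ?_⟩
    filter_upwards [h] with q hq β a z hz
    obtain ⟨hd, hl⟩ := childPoly_leadingCoeff β hq.ne'
    simp only [← eval_childPoly] at hz
    have hz' := eventually_linear_le_of_polynomial hd (hl ▸ hq) hz
    refine ((Negl.sigmoid_of_le (z := fun n => -z n) (δ := (childPoly q.1 q.2 β p).leadingCoeff / 4)
      (by rw [hl]; positivity) ?_).const_mul (-1)).congr fun n => ?_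
    · filter_upwards [hz'] with n hn
      linarith
    · rw [Real.sigmoid_neg]; ring
  · refine ⟨0, ?_⟩
    filter_upwards [h] with q hq β a z hz
    obtain ⟨hd, hl⟩ := childPoly_leadingCoeff β hq.ne
    simp only [← eval_childPoly] at hz
    have hz' := eventually_le_linear_of_polynomial hd (hl ▸ hq) hz
    simpa using Negl.sigmoid_of_le (by rw [hl]; linarith) hz'

/-- The asymptotic expansion of a family as the number of children grows. Whatever a branch receives
from the root does not depend on the number of red bundles of this branch. -/
def HasExpansion (R : Subring (ℝ → ℝ)) (U : Ultrafilter (ℕ × ℕ)) (z : Family) : Prop :=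
  ∃ (c : ℝ) (F : (biRing R)[X]) (loc : Pos → biRing R) (H : Pos → (biRing R)[X]),
    BalancedResp H ∧
    ∀ᶠ q in (U : Filter (ℕ × ℕ)), ∀ β : Bool,
      (Negl fun n => z q.1 q.2 β n .root - (c + childSum q.1 q.2 β n F)) ∧
      ∀ p b, Negl fun n => z q.1 q.2 β n (.node p b) -
        (ev (redCount q.1 b : ℝ) (q.2 : ℝ) (loc p) + childSum q.1 q.2 β n (H p))

variable (R) in
/-- The ring contains what is needed to follow a sigmoid network. -/
structure IsSigmoidRing : Prop where
  const_mem : ∀ c : ℝ, (fun _ => c) ∈ R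
  id_mem : (fun x => x) ∈ R
  sigmoid_mem : ∀ u ∈ R, (fun x => Real.sigmoid (u x)) ∈ R

namespace IsSigmoidRing

/-- A constant function of two variables. -/
def const (hS : IsSigmoidRing R) (a : ℝ) : biRing R :=
  ⟨fun _ _ => a, fun _ => hS.const_mem a, fun _ => hS.const_mem a⟩

/-- The first coordinate. -/
def fstFun (hS : IsSigmoidRing R) : biRing R :=
  ⟨fun x _ => x, fun x => hS.const_mem x, fun _ => hS.id_mem⟩

/-- The second coordinate. -/
def sndFun (hS : IsSigmoidRing R) : biRing R :=
  ⟨fun _ y => y, fun _ => hS.id_mem, fun y => hS.const_mem y⟩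

/-- Composition with the sigmoid function. -/
noncomputable def sigmoidComp (hS : IsSigmoidRing R) (f : biRing R) : biRing R :=
  ⟨fun x y => Real.sigmoid (f.1 x y), fun x => hS.sigmoid_mem _ (f.2.1 x),
    fun y => hS.sigmoid_mem _ (f.2.2 y)⟩

theorem ev_const (hS : IsSigmoidRing R) (a x y : ℝ) : ev x y (hS.const a) = a := rfl
theorem ev_fstFun (hS : IsSigmoidRing R) (x y : ℝ) : ev x y hS.fstFun = x := rfl
theorem ev_sndFun (hS : IsSigmoidRing R) (x y : ℝ) : ev x y hS.sndFun = y := rfl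

end IsSigmoidRing

namespace HasExpansion

theorem const (hS : IsSigmoidRing R) (a : ℝ) : HasExpansion R U fun _ _ _ _ _ => a := by
  refine ⟨a, 0, fun _ => hS.const a, fun _ => 0, BalancedResp.zero, Eventually.of_forall fun q β => ⟨?_, ?_⟩⟩
  · simpa [childSum_zero] using Negl.zero
  · intro p b
    simpa [childSum_zero, hS.ev_const] using Negl.zero

theorem add {z w : Family} (hz : HasExpansion R U z) (hw : HasExpansion R U w) :
    HasExpansion R U fun k K β n v => z k K β n v + w k K β n v := by
  obtain ⟨c, F, loc, H, hH, h⟩ := hz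
  obtain ⟨c', F', loc', H', hH', h'⟩ := hw
  refine ⟨c + c', F + F', fun p => loc p + loc' p, fun p => H p + H' p, hH.add hH', ?_⟩
  filter_upwards [h, h'] with q hq hq' β
  refine ⟨((hq β).1.add (hq' β).1).congr fun n => ?_,
    fun p b => (((hq β).2 p b).add ((hq' β).2 p b)).congr fun n => ?_⟩
  · rw [childSum_add]; ring
  · rw [childSum_add, map_add]; ring

theorem const_mul (hS : IsSigmoidRing R) (a : ℝ) {z : Family} (hz : HasExpansion R U z) :
    HasExpansion R U fun k K β n v => a * z k K β n v := by
  obtain ⟨c, F, loc, H, hH, h⟩ := hz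
  have ha (K : ℕ) : ∀ x : ℝ, ev x (K : ℝ) (hS.const a) = a := fun x => rfl
  refine ⟨a * c, C (hS.const a) * F, fun p => hS.const a * loc p, fun p => C (hS.const a) * H p,
    hH.const_mul _, ?_⟩
  filter_upwards [h] with q hq β
  refine ⟨((hq β).1.const_mul a).congr fun n => ?_,
    fun p b => (((hq β).2 p b).const_mul a).congr fun n => ?_⟩
  · rw [childSum_C_mul _ _ _ _ _ _ a (ha _)]; ring
  · rw [childSum_C_mul _ _ _ _ _ _ a (ha _), map_mul, hS.ev_const]; ring

theorem sum (hS : IsSigmoidRing R) {ι : Type*} (s : Finset ι) (a : ι → ℝ) {z : ι → Family}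
    (hz : ∀ i, HasExpansion R U (z i)) :
    HasExpansion R U fun k K β n v => ∑ i ∈ s, a i * z i k K β n v := by
  classical
  induction s using Finset.induction_on with
  | empty => simpa using const hS 0
  | insert i s hi ih =>
    simp only [Finset.sum_insert hi]
    exact ((hz i).const_mul hS (a i)).add ih

/-- A nonzero response saturates, and a zero response leaves a value that depends on the local data
only. All new responses are zero, so they are trivially balanced and the old balance is not used: it
matters only for aggregations with no activation in between. -/
theorem sigmoid (hS : IsSigmoidRing R) (hU : IsGeneric R U) {z : Family}
    (hz : HasExpansion R U z) : HasExpansion R U fun k K β n v => Real.sigmoid (z k K β n v) := by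
  obtain ⟨c, F, loc, H, -, h⟩ := hz
  have hroot : ∃ c' : ℝ, ∀ᶠ q in (U : Filter (ℕ × ℕ)), ∀ (β : Bool) (z : ℕ → ℝ),
      (Negl fun n => z n - (c + childSum q.1 q.2 β n F)) →
        Negl fun n => Real.sigmoid (z n) - c' := by
    by_cases hF : F = 0
    · refine ⟨Real.sigmoid c, Eventually.of_forall fun q β z hz => ?_⟩
      simp only [hF, childSum_zero, add_zero] at hz
      exact hz.sigmoid_sub
    · obtain ⟨s, hs⟩ := hU.exists_saturation hF
      exact ⟨s, hs.mono fun q hq β z hz => hq β c z hz⟩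
  have hnode : ∀ p, ∃ loc' : biRing R, ∀ᶠ q in (U : Filter (ℕ × ℕ)), ∀ (β b : Bool) (z : ℕ → ℝ),
      (Negl fun n => z n -
        (ev (redCount q.1 b : ℝ) (q.2 : ℝ) (loc p) + childSum q.1 q.2 β n (H p))) →
        Negl fun n => Real.sigmoid (z n) - ev (redCount q.1 b : ℝ) (q.2 : ℝ) loc' := by
    intro p
    by_cases hF : H p = 0
    · refine ⟨hS.sigmoidComp (loc p), Eventually.of_forall fun q β b z hz => ?_⟩
      simp only [hF, childSum_zero, add_zero] at hz
      exact hz.sigmoid_sub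
    · obtain ⟨s, hs⟩ := hU.exists_saturation hF
      exact ⟨hS.const s, hs.mono fun q hq β b z hz => hq β _ z hz⟩
  obtain ⟨c', hc'⟩ := hroot
  choose loc' hloc' using hnode
  refine ⟨c', 0, loc', fun _ => 0, BalancedResp.zero, ?_⟩
  filter_upwards [h, hc', eventually_all.2 hloc'] with q hq hq1 hq2 β
  refine ⟨(hq1 β _ (hq β).1).congr fun n => ?_, fun p b => (hq2 p β b _ ((hq β).2 p b)).congr fun n => ?_⟩
  · rw [childSum_zero, add_zero]
  · rw [childSum_zero, add_zero]

theorem nbSum (hS : IsSigmoidRing R) (hle : ∀ᶠ q in (U : Filter (ℕ × ℕ)), q.1 ≤ q.2) {z : Family}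
    (hz : HasExpansion R U z) : HasExpansion R U fun k K β n => nbSum k K β n (z k K β n) := by
  obtain ⟨c, F, loc, H, hH, h⟩ := hz
  let loc' : Pos → biRing R := fun
    | .hub => hS.const c + hS.fstFun * (hS.const 2 * loc .top) +
        (hS.sndFun - hS.fstFun) * (loc .leaf + loc .fork)
    | .top => loc .hub + loc .mid
    | .mid => loc .top + loc .tip
    | .tip => loc .mid
    | .leaf => loc .hub
    | .fork => loc .hub + hS.const 2 * loc .prong
    | .prong => loc .fork
  -- The local terms of the children enter `F` with the red count of each child as argument. Their
  -- common response occurs once per child, whence the factor `n + 1`.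
  refine ⟨0, C (loc .hub) + (X + 1) * H .hub, loc', respSum F (C hS.sndFun) H, hH.respSum _ _, ?_⟩
  filter_upwards [h, hle] with q hq hkK β
  obtain ⟨hr, hn⟩ := hq β
  refine ⟨?_, fun p b => ?_⟩
  · refine ((hn .hub false).natCast_mul.add (hn .hub β)).congr fun n => ?_
    simp only [_root_.nbSum]
    rw [childSum_add, childSum_C, childSum_succ_mul, show redCount q.1 false = q.1 from rfl]
    ring
  have hrb : redCount q.1 b ≤ q.2 := by
    unfold redCount; split_ifs <;> omega
  cases p
  case hub =>
    -- A blue bundle responds like a red one, so the red count of the branch cancels from the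
    -- response and only `K` remains.
    have e1 : ∀ n, childSum q.1 q.2 β n (H .leaf) + childSum q.1 q.2 β n (H .fork) =
        2 * childSum q.1 q.2 β n (H .top) := fun n => by
      rw [← childSum_add, ← hH.bundle, childSum_add]; ring
    refine ((hr.add (((hn .top b).const_mul 2).const_mul (redCount q.1 b))).add
      (((hn .leaf b).add (hn .fork b)).const_mul ((q.2 : ℝ) - redCount q.1 b))).congr fun n => ?_
    simp only [_root_.nbSum, loc', respSum, Nat.cast_sub hrb, map_add, map_mul, map_sub, hS.ev_const,
      hS.ev_fstFun, hS.ev_sndFun]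
    rw [childSum_add, ← C_add, childSum_C_mul _ _ _ _ _ _ ((q.2 : ℝ) + q.2) (fun x => rfl)]
    linear_combination (-(q.2 : ℝ) + redCount q.1 b) * e1 n
  case top =>
    refine ((hn .hub b).add (hn .mid b)).congr fun n => ?_
    simp only [_root_.nbSum, loc', respSum, map_add, childSum_add]; ring
  case mid =>
    refine ((hn .top b).add (hn .tip b)).congr fun n => ?_
    simp only [_root_.nbSum, loc', respSum, map_add, childSum_add]; ring
  case tip => exact hn .mid b
  case leaf => exact hn .hub b
  case fork =>
    refine ((hn .hub b).add ((hn .prong b).const_mul 2)).congr fun n => ?_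
    simp only [_root_.nbSum, loc', respSum, map_add, map_mul, hS.ev_const, childSum_add]; ring
  case prong => exact hn .fork b

/-- A family with an expansion does not tell the two values of the flag apart at the root. -/
theorem not_separates (hU : IsGeneric R U) {P : ℕ × ℕ → Prop} (hP : ∀ᶠ q in (U : Filter (ℕ × ℕ)), P q)
    {z : Family} (hz : HasExpansion R U z) {ε : ℝ} (hε : ε < 1 / 2)
    (h0 : ∀ q, P q → ∀ᶠ n in atTop, z q.1 q.2 false n .root ≤ ε)
    (h1 : ∀ q, P q → ∀ᶠ n in atTop, 1 - ε ≤ z q.1 q.2 true n .root) : False := by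
  obtain ⟨c, F, _, _, _, h⟩ := hz
  by_cases hF : F = 0
  -- With `F = 0` both flags give the same limit `c`, so `1 - ε ≤ c ≤ ε`, against `ε < 1 / 2`.
  · obtain ⟨q, hPq, hq⟩ := (hP.and h).exists
    have key : ∀ β, Tendsto (fun n => z q.1 q.2 β n .root) atTop (𝓝 c) := fun β => by
      have := (hq β).1.tendsto.add_const c
      simpa [hF, childSum_zero] using this
    have := le_of_tendsto (key false) (h0 q hPq)
    have := ge_of_tendsto (key true) (h1 q hPq)
    linarith
  -- Otherwise the root values for both flags diverge in the same direction: `+∞` violates the bound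
  -- for `false`, and `-∞` the bound for `true`.
  · rcases hU.pos_or_neg (leadingCoeff_ne_zero.2 hF) with hs | hs
    · obtain ⟨q, ⟨hPq, hq⟩, hpos⟩ := ((hP.and h).and hs).exists
      obtain ⟨hd, hl⟩ := childPoly_leadingCoeff false hpos.ne'
      have hq1 := (hq false).1
      simp only [← eval_childPoly] at hq1
      have h3 := eventually_linear_le_of_polynomial hd (hl ▸ hpos) hq1
      have h4 := ((tendsto_natCast_atTop_atTop (R := ℝ)).const_mul_atTop
        (show 0 < (childPoly q.1 q.2 false F).leadingCoeff / 4 by rw [hl]; positivity)).eventually_gt_atTop ε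
      obtain ⟨n, ⟨h3, h4⟩, h5⟩ := ((h3.and h4).and (h0 q hPq)).exists
      linarith
    · obtain ⟨q, ⟨hPq, hq⟩, hneg⟩ := ((hP.and h).and hs).exists
      obtain ⟨hd, hl⟩ := childPoly_leadingCoeff true hneg.ne
      have hq1 := (hq true).1
      simp only [← eval_childPoly] at hq1
      have h3 := eventually_le_linear_of_polynomial hd (hl ▸ hneg) hq1
      have h4 := ((tendsto_natCast_atTop_atTop (R := ℝ)).const_mul_atTop
        (show 0 < -(childPoly q.1 q.2 true F).leadingCoeff / 4 by rw [hl]; linarith)).eventually_gt_atTop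
        (ε - 1)
      obtain ⟨n, ⟨h3, h4⟩, h5⟩ := ((h3.and h4).and (h1 q hPq)).exists
      linarith

end HasExpansion

end Asymptotics

/-! ## Graphs described by classes of vertices -/

section ClassDynamics

/-- The embedding computed by a GNN, at the level of classes, when all vertices have color `i₀` and
`nb` sums over neighborhoods. -/
noncomputable def classEmbedding (σ : ℝ → ℝ) {ℓ : ℕ} (nb : (Cls → ℝ) → Cls → ℝ) (i₀ : Fin ℓ) :
    {d : ℕ} → GNN ℓ d → Cls → Fin d → ℝ
  | _, .first comb => fun v => comb.eval σ (Fin.append (Pi.single i₀ 1)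
      fun i => nb (fun _ => (Pi.single i₀ 1 : Fin ℓ → ℝ) i) v)
  | _, .step prev comb => fun v => comb.eval σ (Fin.append (classEmbedding σ nb i₀ prev v)
      fun i => nb (fun c => classEmbedding σ nb i₀ prev c i) v)

open Classical in
/-- The truth of a formula at the level of classes. -/
noncomputable def classSat {ℓ : ℕ} (nb : (Cls → ℝ) → Cls → ℝ) (i₀ : Fin ℓ) :
    GC2Formula ℓ → Cls → Prop
  | .col i, _ => i₀ = i
  | .neg φ, c => ¬ classSat nb i₀ φ c
  | .and φ ψ, c => classSat nb i₀ φ c ∧ classSat nb i₀ ψ c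
  | .existsGE N _ φ, c => (N : ℝ) ≤ nb (fun c' => if classSat nb i₀ φ c' then 1 else 0) c

open Classical in
/-- The partition of the vertices into classes is equitable, and all vertices have color `i₀`. -/
structure IsClassified {ℓ : ℕ} (G : LabeledGraph ℓ) (cls : G.V → Cls)
    (nb : (Cls → ℝ) → Cls → ℝ) (i₀ : Fin ℓ) : Prop where
  color_eq : ∀ v, G.color v = i₀
  sum_eq : ∀ (f : Cls → ℝ) v, (∑ w, if G.graph.Adj v w then f (cls w) else 0) = nb f (cls v)

variable {ℓ : ℕ} {G : LabeledGraph ℓ} {cls : G.V → Cls} {nb : (Cls → ℝ) → Cls → ℝ} {i₀ : Fin ℓ}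

theorem IsClassified.updateEmbedding_eq (h : IsClassified G cls nb i₀) (σ : ℝ → ℝ) {d e : ℕ}
    (comb : NeuralNetwork (d + d) e) (ξ : G.V → Fin d → ℝ) (η : Cls → Fin d → ℝ)
    (hξ : ∀ v, ξ v = η (cls v)) (v : G.V) :
    updateEmbedding σ G comb ξ v =
      comb.eval σ (Fin.append (η (cls v)) fun i => nb (fun c => η c i) (cls v)) := by
  classical
  unfold updateEmbedding
  rw [hξ v]
  congr 2
  ext i
  rw [← h.sum_eq, SimpleGraph.neighborFinset_eq_filter, Finset.sum_apply, Finset.sum_filter]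
  refine Finset.sum_congr rfl fun w _ => ?_
  simp only [hξ]

theorem IsClassified.embedding_eq (h : IsClassified G cls nb i₀) (σ : ℝ → ℝ) {d : ℕ}
    (N : GNN ℓ d) (v : G.V) : N.embedding σ G v = classEmbedding σ nb i₀ N (cls v) := by
  induction N generalizing v with
  | first comb =>
    exact h.updateEmbedding_eq σ comb _ (fun _ => Pi.single i₀ 1)
      (fun w => by rw [initialEmbedding, h.color_eq]) v
  | step prev comb ih => exact h.updateEmbedding_eq σ comb _ _ ih v

theorem IsClassified.sat_iff (h : IsClassified G cls nb i₀) (φ : GC2Formula ℓ) (v : G.V) :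
    φ.Sat G v ↔ classSat nb i₀ φ (cls v) := by
  classical
  induction φ generalizing v with
  | col i => simp only [GC2Formula.Sat, classSat, h.color_eq]
  | neg φ ih => simp only [GC2Formula.Sat, classSat, ih]
  | and φ ψ ih ih' => simp only [GC2Formula.Sat, classSat, ih, ih']
  | existsGE N hN φ ih =>
    simp only [GC2Formula.Sat, classSat]
    rw [← h.sum_eq, Set.ncard_eq_toFinset_card', ← Nat.cast_le (α := ℝ)]
    simp only [← ih, ← ite_and]
    rw [Finset.sum_boole]
    congr! 3
    ext w
    simp

end ClassDynamics

/-! ### Propagation of expansions through a GNN -/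

namespace HasExpansion

variable {R : Subring (ℝ → ℝ)} {U : Ultrafilter (ℕ × ℕ)} {σ : ℝ → ℝ}

theorem affine (hS : IsSigmoidRing R) {m n : ℕ} (T : (Fin m → ℝ) →ᵃ[ℝ] (Fin n → ℝ))
    {z : Fin m → Family} (hz : ∀ i, HasExpansion R U (z i)) (j : Fin n) :
    HasExpansion R U fun k K β n v => T (fun i => z i k K β n v) j := by
  have hT : ∀ x : Fin m → ℝ,
      T x j = ∑ i, T.linear (fun l => if i = l then 1 else 0) j * x i + T 0 j := by
    intro x
    have h1 : T x = T.linear x + T 0 := by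
      have := T.map_vadd 0 x
      simpa only [vadd_eq_add, add_zero] using this
    rw [h1, Pi.add_apply, LinearMap.pi_apply_eq_sum_univ T.linear x, Finset.sum_apply]
    congr 1
    refine Finset.sum_congr rfl fun i _ => ?_
    rw [Pi.smul_apply, smul_eq_mul, mul_comm]
  have h := (sum hS Finset.univ (fun i => T.linear (fun l => if i = l then 1 else 0) j) hz).add
    (const hS (T 0 j))
  simp only [← hT] at h
  exact h

theorem neuralNetwork (hS : IsSigmoidRing R)
    (hσ : ∀ z, HasExpansion R U z → HasExpansion R U fun k K β n v => σ (z k K β n v))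
    {m n : ℕ} (net : NeuralNetwork m n) {z : Fin m → Family} (hz : ∀ i, HasExpansion R U (z i))
    (j : Fin n) : HasExpansion R U fun k K β n v => net.eval σ (fun i => z i k K β n v) j := by
  induction net with
  | output T => exact affine hS T hz j
  | hidden T rest ih => exact ih (fun i => hσ _ (affine hS T hz i)) j

theorem classEmbedding (hS : IsSigmoidRing R)
    (hσ : ∀ z, HasExpansion R U z → HasExpansion R U fun k K β n v => σ (z k K β n v))
    (hle : ∀ᶠ q in (U : Filter (ℕ × ℕ)), q.1 ≤ q.2) {ℓ : ℕ} (i₀ : Fin ℓ) {d : ℕ}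
    (N : GNN ℓ d) (j : Fin d) :
    HasExpansion R U fun k K β n v => classEmbedding σ (_root_.nbSum k K β n) i₀ N v j := by
  -- One iteration for an arbitrary expanding input, so that the constant initial embedding and the
  -- later layers are handled alike.
  have key : ∀ {d e : ℕ} (comb : NeuralNetwork (d + d) e) (z : Fin d → Family),
      (∀ i, HasExpansion R U (z i)) → ∀ j, HasExpansion R U fun k K β n v =>
        comb.eval σ (Fin.append (fun i => z i k K β n v)
          fun i => _root_.nbSum k K β n (z i k K β n) v) j := by
    intro d e comb z hz j
    have h := neuralNetwork hS hσ comb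
      (z := fun i k K β n v => Fin.append (fun i => z i k K β n v)
          (fun i => _root_.nbSum k K β n (z i k K β n) v) i) (fun i => ?_) j
    · exact h
    · refine Fin.addCases (fun i => ?_) (fun i => ?_) i
      · simpa only [Fin.append_left] using hz i
      · simpa only [Fin.append_right] using (hz i).nbSum hS hle
  induction N with
  | first comb =>
    exact key comb (fun i _ _ _ _ _ => (Pi.single i₀ 1 : Fin ℓ → ℝ) i)
      (fun i => const hS _) j
  | step prev comb ih => exact key comb _ ih j

end HasExpansion

/-! ## The graphs -/

/-- The vertices: the root, its children, and six places for each bundle below a child. -/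
abbrev TreeVertex (n K : ℕ) : Type :=
  Unit ⊕ Option (Fin n) ⊕ (Option (Fin n) × Fin K × Fin 6)

namespace TreeVertex

variable {n K : ℕ}

/-- The root. -/
abbrev root : TreeVertex n K := .inl ()

/-- A child of the root. -/
abbrev child (i : Option (Fin n)) : TreeVertex n K := .inr (.inl i)

/-- A place in a bundle. -/
abbrev slot (i : Option (Fin n)) (j : Fin K) (a : Fin 6) : TreeVertex n K := .inr (.inr (i, j, a))

/-- The kind of a branch. -/
def flag (β : Bool) : Option (Fin n) → Bool
  | none => β
  | some _ => false

/-- Whether a bundle is red. -/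
def isRed (k : ℕ) (β : Bool) (i : Option (Fin n)) (j : Fin K) : Bool :=
  decide ((j : ℕ) < redCount k (flag β i))

/-- The parent of a place in a bundle; two places of a blue bundle are unused. -/
def slotParent (red : Bool) (i : Option (Fin n)) (j : Fin K) (a : Fin 6) : Option (TreeVertex n K) :=
  match red, a with
  | true, 0 => some (child i)
  | true, 1 => some (slot i j 0)
  | true, 2 => some (slot i j 1)
  | true, 3 => some (child i)
  | true, 4 => some (slot i j 3)
  | true, 5 => some (slot i j 4)
  | false, 0 => some (child i)
  | false, 1 => none
  | false, 2 => none
  | false, 3 => some (child i)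
  | false, 4 => some (slot i j 3)
  | false, 5 => some (slot i j 3)

/-- The class of a place in a bundle. -/
def slotCls (red b : Bool) (a : Fin 6) : Cls :=
  match red, a with
  | true, 0 => .node .top b
  | true, 1 => .node .mid b
  | true, 2 => .node .tip b
  | true, 3 => .node .top b
  | true, 4 => .node .mid b
  | true, 5 => .node .tip b
  | false, 0 => .node .leaf b
  | false, 1 => .isolated
  | false, 2 => .isolated
  | false, 3 => .node .fork b
  | false, 4 => .node .prong b
  | false, 5 => .node .prong b

/-- The parent of a vertex. -/
def parent (k : ℕ) (β : Bool) : TreeVertex n K → Option (TreeVertex n K)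
  | .inl _ => none
  | .inr (.inl _) => some root
  | .inr (.inr (i, j, a)) => slotParent (isRed k β i j) i j a

/-- The class of a vertex. -/
def cls (k : ℕ) (β : Bool) : TreeVertex n K → Cls
  | .inl _ => .root
  | .inr (.inl i) => .node .hub (flag β i)
  | .inr (.inr (i, j, a)) => slotCls (isRed k β i j) (flag β i) a

/-- A rank that decreases from a vertex to its parent. -/
def rank : TreeVertex n K → ℕ
  | .inl _ => 0
  | .inr (.inl _) => 1
  | .inr (.inr (_, _, a)) => 2 + a

theorem rank_lt_of_parent {k : ℕ} {β : Bool} {v w : TreeVertex n K} (h : parent k β v = some w) :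
    rank w < rank v := by
  rcases v with _ | i | ⟨i, j, a⟩
  · simp [parent] at h
  · simp only [parent, Option.some.injEq] at h
    subst h; simp [rank]
  · simp only [parent] at h
    generalize isRed k β i j = r at h
    cases r <;> fin_cases a <;> simp [slotParent] at h <;> subst h <;> simp [rank]

end TreeVertex

open TreeVertex

/-- The graph: a forest given by the parents of its vertices. -/
def treeGraph {ℓ : ℕ} (i₀ : Fin ℓ) (k K : ℕ) (β : Bool) (n : ℕ) : LabeledGraph ℓ where
  V := TreeVertex n K
  graph :=
    { Adj := fun v w => parent k β v = some w ∨ parent k β w = some v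
      symm := ⟨fun _ _ h => h.symm⟩
      loopless := ⟨fun _ h => (rank_lt_of_parent (h.elim id id)).false⟩ }
  color _ := i₀

/-- The number `x` if `o` is `v`, and `0` otherwise. -/
noncomputable def pick {α : Type*} [DecidableEq α] (o : Option α) (v : α) (x : ℝ) : ℝ := if o = some v then x else 0

theorem TreeVertex.sum_eq {n K : ℕ} (F : TreeVertex n K → ℝ) :
    ∑ w, F w = F root + (F (child none) + ∑ i, F (child (some i))) +
      ∑ i, ∑ j, (F (slot i j 0) + F (slot i j 1) + F (slot i j 2) + F (slot i j 3) +
        F (slot i j 4) + F (slot i j 5)) := by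
  simp only [Fintype.sum_sum_type, Fintype.sum_prod_type, Fin.sum_univ_six, Fintype.sum_option,
    Finset.univ_unique, Finset.sum_singleton]
  ring

theorem sum_ite_val_lt {K r : ℕ} (hr : r ≤ K) (a b : ℝ) :
    (∑ j : Fin K, if (j : ℕ) < r then a else b) = r * a + ((K - r : ℕ) : ℝ) * b := by
  rw [Fin.sum_univ_eq_sum_range (fun j => if j < r then a else b), ← Finset.sum_range_add_sum_Ico _ hr,
    Finset.sum_congr rfl fun j hj => if_pos (Finset.mem_range.1 hj),
    Finset.sum_congr rfl fun j hj => if_neg (not_lt.2 (Finset.mem_Ico.1 hj).1)]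
  simp

/-- The first sum picks out the parent of `v` and the second its children; together they run over
the neighbors in the forest. -/
theorem sum_pick_parent {k K : ℕ} (hkK : k ≤ K) (β : Bool) {n : ℕ} (f : Cls → ℝ)
    (v : TreeVertex n K) :
    (∑ w, pick (parent k β v) w (f (cls k β w))) + ∑ w, pick (parent k β w) v (f (cls k β w)) =
      nbSum k K β n f (cls k β v) := by
  have hrK : ∀ b, redCount k b ≤ K := fun b => by unfold redCount; split_ifs <;> omega
  rcases v with _ | i | ⟨i, j, a⟩
  · rw [TreeVertex.sum_eq, TreeVertex.sum_eq]
    have h0 : ∀ (r : Bool) (i : Option (Fin n)) (j : Fin K) (a : Fin 6),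
        slotParent r i j a ≠ some (.inl ()) := by
      intro r i j a
      cases r <;> fin_cases a <;> simp [slotParent]
    simp [pick, parent, h0, cls, flag, nbSum, add_comm]
  · have h0 : ∀ (i' : Option (Fin n)) (j : Fin K),
        (∑ a : Fin 6, pick (slotParent (isRed k β i' j) i' j a) (child i)
          (f (slotCls (isRed k β i' j) (flag β i') a))) =
        if i' = i then (if (j : ℕ) < redCount k (flag β i) then 2 * f (.node .top (flag β i))
          else f (.node .leaf (flag β i)) + f (.node .fork (flag β i))) else 0 := by
      intro i' j
      by_cases hi : i' = i
      · subst hi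
        by_cases hr : (j : ℕ) < redCount k (flag β i')
        · simp [pick, isRed, hr, Fin.sum_univ_six, slotParent, slotCls]; ring
        · simp [pick, isRed, hr, Fin.sum_univ_six, slotParent, slotCls]
      · cases isRed k β i' j <;> simp [pick, hi, Fin.sum_univ_six, slotParent]
    simp only [Fin.sum_univ_six] at h0
    rw [TreeVertex.sum_eq, TreeVertex.sum_eq]
    simp only [parent, cls]
    simp only [h0]
    rw [Finset.sum_comm (s := (Finset.univ : Finset (Option (Fin n))))]
    simp [pick, nbSum, sum_ite_val_lt (hrK _)]
    ring
  -- The children of a place lie in its own bundle, so the sum over all vertices reduces to these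
  -- six places.
  · obtain ⟨S, hS⟩ : ∃ S, S = ∑ a' : Fin 6, pick (slotParent (isRed k β i j) i j a') (slot i j a)
            (f (slotCls (isRed k β i j) (flag β i) a')) := ⟨_, rfl⟩
    have h0 : ∀ (i' : Option (Fin n)) (j' : Fin K),
        (∑ a' : Fin 6, pick (slotParent (isRed k β i' j') i' j' a') (slot i j a)
          (f (slotCls (isRed k β i' j') (flag β i') a'))) =
        if i' = i then (if j' = j then S else 0) else 0 := by
      intro i' j'
      by_cases hi : i' = i
      · subst hi
        by_cases hj : j' = j
        · subst hj; simp [hS]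
        · cases isRed k β i' j' <;> simp [pick, hj, Fin.sum_univ_six, slotParent]
      · cases isRed k β i' j' <;> simp [pick, hi, Fin.sum_univ_six, slotParent]
    simp only [Fin.sum_univ_six] at h0
    have h1 : (∑ w, pick (parent k β w) (slot i j a) (f (cls k β w))) = S := by
      rw [TreeVertex.sum_eq]
      simp only [parent, cls]
      simp only [h0, Finset.sum_ite_eq', Finset.sum_ite_irrel, Finset.mem_univ, if_true]
      simp [pick]
    have h2 : (∑ w, pick (parent k β (slot i j a)) w (f (cls k β w))) =
        (parent k β (slot i j a)).elim 0 fun w => f (cls k β w) := by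
      cases parent k β (slot i j a) <;> simp [pick]
    rw [h2, h1, hS]
    simp only [parent, cls]
    generalize hr : isRed k β i j = r
    cases r <;> fin_cases a <;> simp [pick, slotParent, slotCls, hr, nbSum, Fin.sum_univ_six]; ring

theorem treeGraph_isClassified {ℓ : ℕ} (i₀ : Fin ℓ) {k K : ℕ} (hkK : k ≤ K) (β : Bool) (n : ℕ) :
    IsClassified (treeGraph i₀ k K β n) (cls k β) (nbSum k K β n) i₀ := by
  classical
  refine ⟨fun _ => rfl, fun f v => ?_⟩
  change TreeVertex n K at v
  have hadj : ∀ (w : TreeVertex n K) (x : ℝ),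
      (if (treeGraph i₀ k K β n).graph.Adj v w then x else 0) =
        pick (parent k β v) w x + pick (parent k β w) v x := by
    intro w x
    unfold pick
    by_cases h1 : parent k β v = some w
    · have h2 : parent k β w ≠ some v := fun h2 =>
        lt_asymm (rank_lt_of_parent h1) (rank_lt_of_parent h2)
      rw [if_pos h1, if_neg h2, add_zero]
      exact if_pos (Or.inl h1)
    · rw [if_neg h1, zero_add]
      exact if_congr (or_iff_right h1) rfl rfl
  refine (Finset.sum_congr rfl fun w _ => hadj w _).trans ?_
  exact (Finset.sum_add_distrib (M := ℝ) (ι := TreeVertex n K)).trans (sum_pick_parent hkK β f v)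

/-! ## The query -/

namespace GC2Formula

variable {ℓ : ℕ}

/-- A formula that holds everywhere. -/
def top (i₀ : Fin ℓ) : GC2Formula ℓ := .neg (.and (.col i₀) (.neg (.col i₀)))

/-- The vertices of degree two. -/
def degreeTwo (i₀ : Fin ℓ) : GC2Formula ℓ :=
  .and (.existsGE 2 two_pos (top i₀)) (.neg (.existsGE 3 three_pos (top i₀)))

/-- The vertices with a neighbor that has no neighbor of degree two. -/
def neighborWithoutDegreeTwo (i₀ : Fin ℓ) : GC2Formula ℓ :=
  .existsGE 1 one_pos (.neg (.existsGE 1 one_pos (degreeTwo i₀)))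

end GC2Formula

section Query

variable {ℓ : ℕ} (i₀ : Fin ℓ)

theorem classSat_top (nb : (Cls → ℝ) → Cls → ℝ) (c : Cls) : classSat nb i₀ (.top i₀) c := by
  simp [GC2Formula.top, classSat]

theorem classSat_degreeTwo (nb : (Cls → ℝ) → Cls → ℝ) (c : Cls) :
    classSat nb i₀ (.degreeTwo i₀) c ↔ 2 ≤ nb (fun _ => 1) c ∧ nb (fun _ => 1) c < 3 := by
  simp [GC2Formula.degreeTwo, classSat, classSat_top]

theorem classSat_hub {k K n : ℕ} (hk : 1 ≤ k) (hn : 2 ≤ n) (β b : Bool) :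
    classSat (nbSum k K β n) i₀ (.neg (.existsGE 1 one_pos (.degreeTwo i₀))) (.node .hub b) ↔
      b = true := by
  have hn' : (2 : ℝ) ≤ n := by exact_mod_cast hn
  have hk' : (1 : ℝ) ≤ k := by exact_mod_cast hk
  simp only [classSat, nbSum, classSat_degreeTwo]
  -- The root is itself a neighbor of the hub; `2 ≤ n` keeps its degree `n + 1` away from two.
  -- Leaves and forks have degrees one and three, so only a `top` can be the neighbor of degree two.
  have h1 : ¬ (2 ≤ (n : ℝ) + 1 ∧ (n : ℝ) + 1 < 3) := fun h => by linarith [h.2]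
  cases b
  · simp only [redCount]
    norm_num [h1]
    linarith
  · simp only [redCount]
    norm_num [h1]

theorem classSat_root {k K n : ℕ} (hk : 1 ≤ k) (hn : 2 ≤ n) (β : Bool) :
    classSat (nbSum k K β n) i₀ (.neighborWithoutDegreeTwo i₀) .root ↔ β = true := by
  rw [GC2Formula.neighborWithoutDegreeTwo, classSat]
  simp only [nbSum, classSat_hub i₀ hk hn]
  cases β <;> norm_num

end Query

/-! ### Both activations, and the conclusion -/

theorem HasExpansion.activation {R : Subring (ℝ → ℝ)} {U : Ultrafilter (ℕ × ℕ)}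
    (hS : IsSigmoidRing R) (hU : IsGeneric R U) {σ : ℝ → ℝ}
    (hσ : σ = Real.sigmoid ∨ σ = Real.tanh) (z : Family) (hz : HasExpansion R U z) :
    HasExpansion R U fun k K β n v => σ (z k K β n v) := by
  rcases hσ with rfl | rfl
  · exact hz.sigmoid hS hU
  -- The hyperbolic tangent is a sigmoid up to affine maps before and after, so the sigmoid case
  -- suffices.
  · have htanh : ∀ x : ℝ, Real.tanh x = 2 * Real.sigmoid (2 * x) + -1 := by
      intro x
      rw [Real.tanh_eq, Real.sigmoid_def, Real.exp_neg, Real.exp_neg,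
        show Real.exp (2 * x) = Real.exp x * Real.exp x by rw [← Real.exp_add]; ring_nf]
      have := Real.exp_pos x
      field_simp
      ring
    simp only [htanh]
    exact ((((hz.const_mul hS 2).sigmoid hS hU)).const_mul hS 2).add (const hS (-1))

theorem corollary1 (σ : ℝ → ℝ) (hσ : σ = Real.sigmoid ∨ σ = Real.tanh)
    (ℓ : ℕ) (hℓ : 0 < ℓ) :
    ∃ Q : UnaryQuery ℓ, IsGC2Query Q ∧
      ∀ N : GNN ℓ 1, ¬ N.ExpressesUniformly σ Q := by
  let i₀ : Fin ℓ := ⟨0, hℓ⟩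
  refine ⟨fun G => {v | (GC2Formula.neighborWithoutDegreeTwo i₀).Sat G v},
    ⟨_, fun _ _ => Iff.rfl⟩, ?_⟩
  rintro N ⟨ε, hε, hN⟩
  obtain ⟨R, hT, hconst, hid, hsig⟩ := exists_isTame_sigmoid
  have hS : IsSigmoidRing R := ⟨hconst, hid, hsig⟩
  have : ((atTop : Filter ℕ).curry (atTop : Filter ℕ)).NeBot := by
    refine ⟨fun h => ?_⟩
    have h' : ∀ᶠ _ in (atTop : Filter ℕ).curry (atTop : Filter ℕ), False := by simp [h]
    rw [eventually_curry_iff] at h'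
    obtain ⟨_, hk⟩ := h'.exists
    exact hk.exists.elim fun _ => id
  -- The curried filter makes the parameters generic with `k ≤ K`; passing to an ultrafilter also
  -- settles the signs of all leading coefficients.
  let U : Ultrafilter (ℕ × ℕ) := Ultrafilter.of ((atTop : Filter ℕ).curry atTop)
  have hUle : (U : Filter (ℕ × ℕ)) ≤ (atTop : Filter ℕ).curry atTop := Ultrafilter.of_le _
  have hU : IsGeneric R U := fun f hf => hUle (biRing.eventually_ne_zero hT hf)
  have hP : ∀ᶠ q in (U : Filter (ℕ × ℕ)), 1 ≤ q.1 ∧ q.1 ≤ q.2 := by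
    refine hUle (eventually_curry_iff.2 ?_)
    filter_upwards [eventually_ge_atTop 1] with k hk
    filter_upwards [eventually_ge_atTop k] with K hK using ⟨hk, hK⟩
  have hz := HasExpansion.classEmbedding hS (HasExpansion.activation hS hU hσ)
    (hP.mono fun _ h => h.2) i₀ N 0
  have hroot : ∀ (q : ℕ × ℕ) (β : Bool) (n : ℕ), 1 ≤ q.1 ∧ q.1 ≤ q.2 → 2 ≤ n →
      (β = true → 1 - ε ≤ classEmbedding σ (nbSum q.1 q.2 β n) i₀ N .root 0) ∧
        (¬ β = true → classEmbedding σ (nbSum q.1 q.2 β n) i₀ N .root 0 ≤ ε) := by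
    intro q β n hq hn
    have hG := treeGraph_isClassified i₀ hq.2 β n
    have h := hN (treeGraph i₀ q.1 q.2 β n) trivial TreeVertex.root
    have hemb := congrFun (hG.embedding_eq σ N (TreeVertex.root : TreeVertex n q.2)) 0
    have hsat := (hG.sat_iff (.neighborWithoutDegreeTwo i₀)
      (TreeVertex.root : TreeVertex n q.2)).trans (classSat_root i₀ hq.1 hn β)
    exact ⟨fun hβ => (h.1 (hsat.2 hβ)).trans_eq hemb,
      fun hβ => hemb.symm.trans_le (h.2 fun hs => hβ (hsat.1 hs))⟩
  refine hz.not_separates hU hP hε (fun q hq => ?_) fun q hq => ?_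
  · filter_upwards [eventually_ge_atTop 2] with n hn
    exact (hroot q false n hq hn).2 (by simp)
  · filter_upwards [eventually_ge_atTop 2] with n hn
    exact (hroot q true n hq hn).1 rfl
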